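/- Let $0\le k\le\infty$, let $S^1$ be the unit circle, and let $C^k(S^1,\mathbb R)$ be the set of real-valued $C^k$ functions on $S^1$, i.e. of $2\pi$-periodic real-valued $C^k$ functions on the line (for $k=0$: continuous functions). For $g\in C^k(S^1,\mathbb R)$ let $\hat g=(\hat g(n))_{n\in\mathbb Z}$, $\hat g(n)=\frac1{2\pi}\int_0^{2\pi} g(e^{ix})e^{-inx}\,dx$, be its sequence of Fourier coefficients, and let $E_k\subset\ell_2(\mathbb Z)$ be the set of all sequences $\hat g$ with $g\in C^k(S^1,\mathbb R)$. For $a,b\in\ell_2(\mathbb Z)$ let $a*b$ be the convolution $(a*b)_n=\sum_{j\in\mathbb Z}a_jb_{n-j}$. Let $F\colon C^k(S^1,\mathbb R)\to E_k$ be a bijection (not assumed linear or continuous) such that $F(f\cdot g)=(Ff)*(Fg)$ for all $f,g\in C^k(S^1,\mathbb R)$. Then there exist a continuous function $p\colon S^1\to(0,\infty)$ and a $C^k$-diffeomorphism $u\colon S^1\to S^1$ (a homeomorphism if $k=0$) such that for every $f\in C^k(S^1,\mathbb R)$ the function $$g(x)=|f(u(x))|^{p(x)}\,\mathrm{sgn}(f(u(x))),\qquad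 x\in S^1,$$ belongs to $C^k(S^1,\mathbb R)$ and $Ff=\hat g$. If moreover $k\ge1$, then $p\equiv1$, i.e. $Ff=\widehat{f\circ u}$ for every $f$. -/

import Mathlib

open scoped Manifold ContDiff

/-- The real-valued functions of class `C^k` on the unit circle `S¹` (with its usual
structure of analytic manifold), `0 ≤ k ≤ ∞`; composing with `x ↦ e^{ix}` identifies
them with the `2π`-periodic real-valued `C^k` functions on the line. -/
abbrev CkCircle (k : ℕ∞) : Type :=
  C^(k : WithTop ℕ∞)⟮𝓡 1, Circle; 𝓘(ℝ, ℝ), ℝ⟯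

/-- The sequence of Fourier coefficients of `f`, as a `2π`-periodic function. -/
noncomputable def fourierSeq {k : ℕ∞} (f : CkCircle k) (n : ℤ) : ℂ :=
  fourierCoeffOn Real.two_pi_pos (fun x : ℝ => ((f (Circle.exp x) : ℝ) : ℂ)) n

/-- The explicit formula `f̂(n) = (1/2π) ∫₀^{2π} f(e^{ix}) e^{-inx} dx`. -/
theorem fourierSeq_eq_integral {k : ℕ∞} (f : CkCircle k) (n : ℤ) :
    fourierSeq f n = (1 / (2 * Real.pi) : ℂ) *
      ∫ x in (0 : ℝ)..(2 * Real.pi),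
        ((f (Circle.exp x) : ℝ) : ℂ) * Complex.exp (-(n * x * Complex.I)) := by
  have hpi : (Real.pi : ℂ) ≠ 0 := by exact_mod_cast Real.pi_ne_zero
  rw [fourierSeq, fourierCoeffOn_eq_integral, Complex.real_smul]
  congr 1
  · push_cast
    simp
  · refine intervalIntegral.integral_congr fun x _ => ?_
    simp only [fourier_coe_apply, smul_eq_mul]
    rw [mul_comm]
    congr 2
    push_cast
    field_simp
    ring

/-- `E_k`: the square-summable sequences that are the Fourier coefficients of some real-valued
`C^k` function on the circle. -/
def fourierClass (k : ℕ∞) : Set (ℤ → ℂ) :=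
  {a | Memℓp a 2 ∧ ∃ f : CkCircle k, fourierSeq f = a}

/-- The convolution (Cauchy product) of two-sided sequences. For square-summable sequences the
series converges absolutely. -/
noncomputable def seqConv (a b : ℤ → ℂ) (n : ℤ) : ℂ :=
  ∑' j : ℤ, a j * b (n - j)

open Filter Set Function
open scoped Topology ComplexConjugate

/-! ### The algebra of `C^k` functions: bumps and local exponentials. -/

namespace CkCircle

/-! A real `C^k` function is determined by its Fourier coefficients, and products become
convolutions (`fourierSeq_mul`), so `F` is the Fourier transform of a multiplicative bijection `T`
of `C^k`.

Multiplicativity makes `T` local: `f = g` near `x` means `f * b = g * b` for a bump `b`, and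
compactness attaches to `x` a point `y` such that `T f` near `y` depends only on `f` near `x`
(`exists_point`). This gives a homeomorphism of the circle. On exponentials, `φ ↦ log (T (e^φ) y)`
is additive, hence linear in `φ x` as soon as it is monotone. Failure of monotonicity at infinitely
many points is impossible: high powers glued around them would form a `C^k` function whose image is
unbounded (`finite_setOf_logMap_pos`). The remaining points are dense, so continuity gives `T (e^φ)
y = e^(p y * φ x)` everywhere; signs follow from `T (-1) = -1`.

Smoothness of the change of variables comes from writing `φ x` as a quotient of two logarithms of
images. For `k ≥ 1`, differentiability of the image of a function with a simple zero forces `p ≥ 1`;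
the same for `T.symm`, whose exponent is the reciprocal, forces `p = 1`. -/

theorem continuous_coe {k : ℕ∞} (f : CkCircle k) : Continuous f := f.contMDiff.continuous

/-- Postcomposition of a `C^k` function on the circle with the exponential. -/
noncomputable def exp {k : ℕ∞} (φ : CkCircle k) : CkCircle k :=
  ⟨fun x => Real.exp (φ x), Real.contDiff_exp.contMDiff.comp φ.contMDiff⟩

@[simp] theorem exp_apply {k : ℕ∞} (φ : CkCircle k) (x : Circle) : exp φ x = Real.exp (φ x) := rfl

@[simp] theorem mul_apply {k : ℕ∞} (f g : CkCircle k) (x : Circle) : (f * g) x = f x * g x := rfl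

@[simp] theorem add_apply {k : ℕ∞} (f g : CkCircle k) (x : Circle) : (f + g) x = f x + g x := rfl

@[simp] theorem sub_apply {k : ℕ∞} (f g : CkCircle k) (x : Circle) : (f - g) x = f x - g x := rfl

@[simp] theorem neg_apply {k : ℕ∞} (f : CkCircle k) (x : Circle) : (-f) x = -f x := rfl

@[simp] theorem one_apply {k : ℕ∞} (x : Circle) : (1 : CkCircle k) x = 1 := rfl

@[simp] theorem zero_apply {k : ℕ∞} (x : Circle) : (0 : CkCircle k) x = 0 := rfl

@[simp] theorem pow_apply {k : ℕ∞} (f : CkCircle k) (n : ℕ) (x : Circle) : (f ^ n) x = f x ^ n :=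
  congrFun (ContMDiffMap.coe_pow f n) x

@[simp] theorem nsmul_apply {k : ℕ∞} (n : ℕ) (f : CkCircle k) (x : Circle) :
    (n • f) x = n * f x := by
  induction n with
  | zero => simp
  | succ n ih => rw [succ_nsmul, add_apply, ih]; push_cast; ring

@[simp] theorem natCast_apply {k : ℕ∞} (n : ℕ) (x : Circle) : (n : CkCircle k) x = n := by
  rw [← nsmul_one, nsmul_apply, one_apply, mul_one]

/-- The constant function with value `c`. -/
noncomputable def const (k : ℕ∞) (c : ℝ) : CkCircle k := ContMDiffMap.const c

@[simp] theorem const_apply {k : ℕ∞} (c : ℝ) (x : Circle) : const k c x = c := rfl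

theorem exp_add {k : ℕ∞} (φ ψ : CkCircle k) : exp (φ + ψ) = exp φ * exp ψ := by
  ext x
  simp [Real.exp_add]

theorem exp_zero {k : ℕ∞} : exp (0 : CkCircle k) = 1 := by
  ext x
  simp

theorem exists_bump {k : ℕ∞} (x : Circle) {U : Set Circle} (hU : U ∈ 𝓝 x) :
    ∃ h : CkCircle k, h =ᶠ[𝓝 x] 1 ∧ tsupport h ⊆ U ∧ ∀ y, h y ∈ Icc (0 : ℝ) 1 := by
  obtain ⟨f, -, hf⟩ := (SmoothBumpFunction.nhds_basis_tsupport (I := 𝓡 1) x).mem_iff.1 hU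
  exact ⟨⟨f, f.contMDiff.of_le (by exact_mod_cast le_top)⟩, f.eventuallyEq_one, hf,
    fun y => f.mem_Icc⟩

theorem exists_eq_exp {k : ℕ∞} (f : CkCircle k) (hf : ∀ x, 0 < f x) :
    ∃ φ : CkCircle k, f = exp φ := by
  refine ⟨⟨fun x => Real.log (f x), fun x => ?_⟩, ?_⟩
  · exact (Real.contDiffAt_log.2 (hf x).ne').contMDiffAt.comp x (f.contMDiff x)
  · ext x
    exact (Real.exp_log (hf x)).symm

theorem exists_eventuallyEq_exp {k : ℕ∞} (f : CkCircle k) {x : Circle} (hx : 0 < f x) :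
    ∃ φ : CkCircle k, f =ᶠ[𝓝 x] exp φ := by
  obtain ⟨h, h1, hs, hI⟩ := exists_bump (k := k) x
    (f.continuous_coe.continuousAt.eventually (lt_mem_nhds hx))
  -- Blending with the constant `1` keeps the function positive off the support of the bump.
  obtain ⟨φ, hφ⟩ := exists_eq_exp (h * f + (1 - h)) fun y => by
    simp only [add_apply, mul_apply, sub_apply, one_apply]
    by_cases hy : h y = 0
    · simp [hy]
    · have : 0 < f y := hs (subset_tsupport _ hy)
      have h0 := lt_of_le_of_ne (hI y).1 (Ne.symm hy)
      have := mul_pos h0 this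
      linarith [(hI y).2]
  refine ⟨φ, ?_⟩
  rw [← hφ]
  filter_upwards [h1] with y hy
  simp [hy]

end CkCircle

/-! ### Locality and the point map. -/

namespace CkCircle

theorem exists_mul_eq_of_eventuallyEq {k : ℕ∞} {f g : CkCircle k} {x : Circle}
    (h : f =ᶠ[𝓝 x] g) {U : Set Circle} (hU : U ∈ 𝓝 x) :
    ∃ b : CkCircle k, b =ᶠ[𝓝 x] 1 ∧ tsupport b ⊆ U ∧ f * b = g * b := by
  obtain ⟨b, h1, hs, -⟩ := exists_bump (k := k) x (inter_mem hU h)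
  refine ⟨b, h1, hs.trans inter_subset_left, ?_⟩
  ext y
  by_cases hy : b y = 0
  · simp [hy]
  · have : f y = g y := (hs (subset_tsupport _ hy)).2
    simp [this]

/-- If `h = 1` near `x`, then `h * b = b` for some bump `b` at `x`, so `T h = 1` wherever `T b ≠ 0`.
The closed supports of such `T h` are therefore a directed family of nonempty compact sets, and `y`
is a common point. -/
theorem exists_point {k : ℕ∞} (T : CkCircle k ≃* CkCircle k) (x : Circle) :
    ∃ y, ∀ h : CkCircle k, h =ᶠ[𝓝 x] 1 → T h =ᶠ[𝓝 y] 1 := by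
  have key : ∀ h : CkCircle k, h =ᶠ[𝓝 x] 1 → ∃ b : CkCircle k, b =ᶠ[𝓝 x] 1 ∧
      T h * T b = T b := by
    intro h hh
    obtain ⟨b, hb, -, e⟩ := exists_mul_eq_of_eventuallyEq (f := h) (g := 1) hh univ_mem
    exact ⟨b, hb, by rw [← map_mul, e, one_mul]⟩
  have sub : ∀ h b : CkCircle k, T h * T b = T b → ∀ y, T b y ≠ 0 → T h y = 1 := by
    intro h b e y hy
    have := DFunLike.congr_fun e y
    rw [mul_apply] at this
    exact mul_right_cancel₀ hy (by rw [this, one_mul])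
  have subs : ∀ h b : CkCircle k, T h * T b = T b → tsupport (T b) ⊆ tsupport (T h) := by
    intro h b e
    refine closure_mono fun y hy => ?_
    rw [mem_support, sub h b e y hy]
    exact one_ne_zero
  have ne : (⋂ h : {h : CkCircle k // h =ᶠ[𝓝 x] 1}, tsupport (T h.1)).Nonempty := by
    have : Nonempty {h : CkCircle k // h =ᶠ[𝓝 x] 1} := ⟨⟨1, EventuallyEq.rfl⟩⟩
    refine IsCompact.nonempty_iInter_of_directed_nonempty_isCompact_isClosed _ ?_ ?_
      (fun _ => (isClosed_tsupport _).isCompact) (fun _ => isClosed_tsupport _)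
    · rintro ⟨h, hh⟩ ⟨g, hg⟩
      have hhg : (h * g : CkCircle k) =ᶠ[𝓝 x] 1 := by
        filter_upwards [hh, hg] with y h1 h2
        simp [h1, h2]
      obtain ⟨b, hb, e⟩ := key h hh
      obtain ⟨c, hc, e'⟩ := key g hg
      refine ⟨⟨b * c, ?_⟩, subs h _ ?_, subs g _ ?_⟩
      · filter_upwards [hb, hc] with y h1 h2
        simp [h1, h2]
      · rw [map_mul, ← mul_assoc, e]
      · rw [map_mul, mul_left_comm, e']
    · rintro ⟨h, hh⟩
      refine closure_nonempty_iff.2 ?_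
      rw [support_nonempty_iff]
      intro h0
      have : T h = 0 := DFunLike.coe_injective h0
      rw [map_eq_zero_iff T T.injective] at this
      have := hh.self_of_nhds
      simp_all
  obtain ⟨y, hy⟩ := ne
  rw [mem_iInter] at hy
  refine ⟨y, fun h hh => ?_⟩
  obtain ⟨b, hb, e⟩ := key h hh
  -- A second bump gives `T b = 1` on the closed support of `T c`, hence at `y`; so `T b ≠ 0` on a
  -- whole neighbourhood of `y`.
  obtain ⟨c, hc, e'⟩ := key b hb
  have hcl : closure (support (T c)) ⊆ {z | T b z = 1} :=
    closure_minimal (fun z hz => sub b c e' z hz)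
      (isClosed_eq (T b).continuous_coe continuous_const)
  have hby : T b y = 1 := hcl (hy ⟨c, hc⟩)
  filter_upwards [(T b).continuous_coe.continuousAt.eventually_ne
    (by rw [hby]; exact one_ne_zero : T b y ≠ 0)] with z hz
  exact sub h b e z hz

/-- The point map of a multiplicative bijection. -/
noncomputable def pointMap {k : ℕ∞} (T : CkCircle k ≃* CkCircle k) (x : Circle) : Circle :=
  (exists_point T x).choose

theorem map_eventuallyEq_one {k : ℕ∞} (T : CkCircle k ≃* CkCircle k) {x : Circle}
    {h : CkCircle k} (hh : h =ᶠ[𝓝 x] 1) : T h =ᶠ[𝓝 (pointMap T x)] 1 :=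
  (exists_point T x).choose_spec h hh

theorem pointMap_symm_pointMap {k : ℕ∞} (T : CkCircle k ≃* CkCircle k) (x : Circle) :
    pointMap T.symm (pointMap T x) = x := by
  by_contra hne
  obtain ⟨h, h1, hs, -⟩ := exists_bump (k := k) x (compl_singleton_mem_nhds (Ne.symm hne))
  have := (map_eventuallyEq_one T.symm (map_eventuallyEq_one T h1)).self_of_nhds
  rw [T.symm_apply_apply] at this
  have h0 : h (pointMap T.symm (pointMap T x)) ≠ 0 := by
    rw [this]
    exact one_ne_zero
  exact hs (subset_tsupport _ h0) rfl

theorem continuous_pointMap {k : ℕ∞} (T : CkCircle k ≃* CkCircle k) :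
    Continuous (pointMap T) := by
  rw [continuous_iff_continuousAt]
  intro x U hU
  obtain ⟨g, g1, hs, -⟩ := exists_bump (k := k) _ hU
  have hg := map_eventuallyEq_one T.symm g1
  rw [pointMap_symm_pointMap] at hg
  rw [mem_map]
  filter_upwards [hg.eventuallyEq_nhds] with x' hx'
  have := (map_eventuallyEq_one T hx').self_of_nhds
  rw [T.apply_symm_apply] at this
  have h0 : g (pointMap T x') ≠ 0 := by
    rw [this]
    exact one_ne_zero
  exact hs (subset_tsupport _ h0)

/-- The point map of a multiplicative bijection, as a homeomorphism. -/
noncomputable def pointHomeo {k : ℕ∞} (T : CkCircle k ≃* CkCircle k) : Circle ≃ₜ Circle where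
  toFun := pointMap T
  invFun := pointMap T.symm
  left_inv := pointMap_symm_pointMap T
  right_inv := pointMap_symm_pointMap T.symm
  continuous_toFun := continuous_pointMap T
  continuous_invFun := continuous_pointMap T.symm

theorem map_eventuallyEq {k : ℕ∞} (T : CkCircle k ≃* CkCircle k) {x : Circle}
    {f g : CkCircle k} (h : f =ᶠ[𝓝 x] g) : T f =ᶠ[𝓝 (pointMap T x)] T g := by
  obtain ⟨b, hb, -, e⟩ := exists_mul_eq_of_eventuallyEq h univ_mem
  filter_upwards [map_eventuallyEq_one T hb] with y hy
  have := DFunLike.congr_fun (congrArg T e) y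
  simpa [hy] using this

theorem map_apply_congr {k : ℕ∞} (T : CkCircle k ≃* CkCircle k) {x : Circle}
    {f g : CkCircle k} (h : f =ᶠ[𝓝 x] g) : T f (pointMap T x) = T g (pointMap T x) :=
  (map_eventuallyEq T h).self_of_nhds

/-- Nonvanishing at `x` is local invertibility, which `T` preserves; the local inverse of `f` is `f
* e^(-φ)` with `f² = e^φ` near `x`. -/
theorem map_apply_ne_zero {k : ℕ∞} (T : CkCircle k ≃* CkCircle k) {x : Circle}
    {f : CkCircle k} (hf : f x ≠ 0) : T f (pointMap T x) ≠ 0 := by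
  obtain ⟨φ, hφ⟩ := exists_eventuallyEq_exp (f * f) (x := x) (mul_self_pos.2 hf)
  have h1 : (f * (f * exp (-φ)) : CkCircle k) =ᶠ[𝓝 x] (1 : CkCircle k) := by
    filter_upwards [hφ] with y hy
    rw [mul_apply, exp_apply] at hy
    simp only [mul_apply, exp_apply, neg_apply, one_apply]
    rw [← mul_assoc, hy, ← Real.exp_add, add_neg_cancel, Real.exp_zero]
  have := map_apply_congr T h1
  rw [map_mul, map_one, mul_apply, one_apply] at this
  exact left_ne_zero_of_mul_eq_one this

theorem map_apply_eq_zero_iff {k : ℕ∞} (T : CkCircle k ≃* CkCircle k) {x : Circle}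
    {f : CkCircle k} : T f (pointMap T x) = 0 ↔ f x = 0 := by
  refine ⟨fun h => by_contra fun hf => map_apply_ne_zero T hf h, fun h => by_contra fun hf => ?_⟩
  have := map_apply_ne_zero T.symm hf
  rw [T.symm_apply_apply, pointMap_symm_pointMap] at this
  exact this h

end CkCircle

/-! ### Decay of high powers and gluing. -/

theorem Circle.exp_arg_add_arg (z w : Circle) :
    Circle.exp (Complex.arg (z * w⁻¹ : Circle) + Complex.arg w) = z := by
  rw [Circle.exp_add, Circle.exp_arg, Circle.exp_arg, inv_mul_cancel_right]

/-- A function on the circle is `C^n` as soon as its lift to the line is. -/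
theorem Circle.contMDiff_of_comp_exp {E : Type*} [NormedAddCommGroup E] [NormedSpace ℝ E]
    {n : WithTop ℕ∞} {f : Circle → E} (hf : ContDiff ℝ n fun t : ℝ => f (Circle.exp t)) :
    ContMDiff (𝓡 1) 𝓘(ℝ, E) n f := by
  intro w
  have h1 : ContMDiffAt (𝓡 1) 𝓘(ℝ, ℂ) n (fun z : Circle => ((z * w⁻¹ : Circle) : ℂ)) w := by
    have h0 : ContMDiff (𝓡 1) (𝓡 1) n (fun z : Circle => z * w⁻¹) :=
      ContMDiff.mul contMDiff_id contMDiff_const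
    have : Fact (Module.finrank ℝ ℂ = 1 + 1) := finrank_real_complex_fact'
    have h2 : ContMDiff (𝓡 1) 𝓘(ℝ, ℂ) n (fun z : Circle => (z : ℂ)) := contMDiff_coe_sphere
    exact (h2.comp h0) w
  have h2 : ContDiffAt ℝ n Complex.arg ((w * w⁻¹ : Circle) : ℂ) := by
    have : ContDiffAt ℝ n Complex.log ((w * w⁻¹ : Circle) : ℂ) := by
      refine (Complex.contDiffAt_log ?_).restrict_scalars ℝ
      simp
    have h := Complex.imCLM.contDiff.contDiffAt.comp _ this
    have e : ⇑Complex.imCLM ∘ Complex.log = Complex.arg := by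
      ext z
      simp [Complex.log_im]
    rwa [e] at h
  have h3 := (h2.contMDiffAt.comp w h1).add (contMDiffAt_const (c := Complex.arg w))
  have h4 := (hf.contMDiff _).comp w h3
  refine h4.congr_of_eventuallyEq (Eventually.of_forall fun z => ?_)
  exact congrArg f (Circle.exp_arg_add_arg z w).symm

theorem Function.Periodic.deriv_periodic {f : ℝ → ℝ} {c : ℝ} (hf : Periodic f c) :
    Periodic (deriv f) c := by
  intro x
  rw [← deriv_comp_add_const]
  congr 1
  ext y
  exact hf y

theorem Function.Periodic.exists_abs_le {f : ℝ → ℝ} {c : ℝ} (hc : 0 < c) (hf : Periodic f c)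
    (hcont : Continuous f) : ∃ x₀, ∀ x, |f x| ≤ |f x₀| := by
  obtain ⟨x₀, -, h⟩ := (isCompact_Icc (a := (0 : ℝ)) (b := c)).exists_isMaxOn
    (nonempty_Icc.2 hc.le) hcont.abs.continuousOn
  refine ⟨x₀, fun x => ?_⟩
  obtain ⟨y, hy, e⟩ := hf.exists_mem_Ico₀ hc x
  rw [e]
  exact h (Ico_subset_Icc_self hy)

/-- The derivatives of `b * a ^ m` decay superpolynomially in `m` if `|a| < 1`. -/
theorem eventually_abs_iteratedDeriv_mul_pow_le {c : ℝ} (hc : 0 < c) (j : ℕ) :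
    ∀ (l : ℕ) {a b : ℝ → ℝ}, ContDiff ℝ j a → ContDiff ℝ j b → Periodic a c → Periodic b c →
      (∀ x, |a x| < 1) → ∀ ε > 0, ∀ᶠ m : ℕ in atTop, ∀ x,
        (m : ℝ) ^ l * |iteratedDeriv j (fun t => b t * a t ^ m) x| ≤ ε := by
  induction j with
  | zero =>
    intro l a b ha hb pa pb hlt ε hε
    obtain ⟨x₀, h₀⟩ := pa.exists_abs_le hc ha.continuous
    obtain ⟨x₁, h₁⟩ := pb.exists_abs_le hc hb.continuous
    have h := (tendsto_pow_const_mul_const_pow_of_abs_lt_one l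
      (r := |a x₀|) (by rw [abs_abs]; exact hlt x₀)).const_mul |b x₁|
    rw [mul_zero] at h
    filter_upwards [h.eventually (gt_mem_nhds hε)] with m hm x
    refine le_trans ?_ hm.le
    rw [iteratedDeriv_zero, abs_mul, abs_pow, mul_left_comm]
    exact mul_le_mul (h₁ x) (mul_le_mul_of_nonneg_left (pow_le_pow_left₀ (abs_nonneg _) (h₀ x) m)
      (by positivity)) (by positivity) (abs_nonneg _)
  | succ j ih =>
    intro l a b ha hb pa pb hlt ε hε
    have ha' : ContDiff ℝ j (deriv a) := ((contDiff_succ_iff_deriv (n := j)).1 ha).2.2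
    have hb' : ContDiff ℝ j (deriv b) := ((contDiff_succ_iff_deriv (n := j)).1 hb).2.2
    have hda : Differentiable ℝ a := ((contDiff_succ_iff_deriv (n := j)).1 ha).1
    have hdb : Differentiable ℝ b := ((contDiff_succ_iff_deriv (n := j)).1 hb).1
    have ha0 : ContDiff ℝ j a := ha.of_le (by exact_mod_cast j.le_succ)
    have hb0 : ContDiff ℝ j b := hb.of_le (by exact_mod_cast j.le_succ)
    have e1 := ih l ha0 hb' pa pb.deriv_periodic hlt (ε / 2) (half_pos hε)
    -- Differentiating `a ^ (m + 1)` costs a factor `m + 1`, paid for by one more power of `m`; the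
    -- `2 ^ (l + 1)` absorbs `m + 1 ≤ 2 * m`.
    have e2 := ih (l + 1) ha0 (hb0.mul ha') pa (pb.mul pa.deriv_periodic) hlt
      (ε / 2 / 2 ^ (l + 1)) (by positivity)
    -- The shift to `m + 1` avoids truncated subtraction in the power rule.
    rw [← Filter.map_add_atTop_eq_nat 1, eventually_map]
    filter_upwards [(tendsto_add_atTop_nat 1).eventually e1, e2, eventually_ge_atTop 1]
      with m h1 h2 hm x
    have hd : deriv (fun t => b t * a t ^ (m + 1)) = (fun t => deriv b t * a t ^ (m + 1)) +
        fun t => ((m : ℝ) + 1) * ((b * deriv a) t * a t ^ m) := by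
      ext t
      have := (hdb t).hasDerivAt.mul ((hda t).hasDerivAt.pow (m + 1))
      refine (HasDerivAt.deriv this).trans ?_
      simp only [Pi.add_apply, Pi.mul_apply, Pi.pow_apply]
      rw [Nat.add_sub_cancel]
      push_cast
      ring
    have hA : ContDiffAt ℝ j (fun t => deriv b t * a t ^ (m + 1)) x :=
      (hb'.mul (ha0.pow _)).contDiffAt
    have hB : ContDiffAt ℝ j (fun t => ((m : ℝ) + 1) * ((b * deriv a) t * a t ^ m)) x :=
      (contDiff_const.mul ((hb0.mul ha').mul (ha0.pow _))).contDiffAt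
    rw [iteratedDeriv_succ', hd, iteratedDeriv_add hA hB,
      iteratedDeriv_const_mul_field]
    have h1x := h1 x
    have h2x := h2 x
    rw [le_div_iff₀ (by positivity)] at h2x
    have hm' : (1 : ℝ) ≤ m := by exact_mod_cast hm
    push_cast at h1x ⊢
    set A := iteratedDeriv j (fun t => deriv b t * a t ^ (m + 1)) x
    set B := iteratedDeriv j (fun t => (b * deriv a) t * a t ^ m) x
    have hAB : |A + (m + 1) * B| ≤ |A| + (m + 1) * |B| := by
      refine (abs_add_le _ _).trans ?_
      rw [abs_mul, abs_of_nonneg (by positivity : (0 : ℝ) ≤ m + 1)]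
    have hp : ((m : ℝ) + 1) ^ (l + 1) ≤ m ^ (l + 1) * 2 ^ (l + 1) := by
      rw [← mul_pow]
      gcongr
      linarith
    calc ((m : ℝ) + 1) ^ l * |A + (m + 1) * B|
        ≤ (m + 1) ^ l * (|A| + (m + 1) * |B|) := by gcongr
      _ = (m + 1) ^ l * |A| + (m + 1) ^ (l + 1) * |B| := by ring
      _ ≤ ε / 2 + m ^ (l + 1) * 2 ^ (l + 1) * |B| := by gcongr
      _ = ε / 2 + m ^ (l + 1) * |B| * 2 ^ (l + 1) := by ring
      _ ≤ ε / 2 + ε / 2 := add_le_add_right h2x _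
      _ = ε := by ring

namespace CkCircle

theorem contDiff_comp_exp {k : ℕ∞} (f : CkCircle k) :
    ContDiff ℝ k fun t : ℝ => f (Circle.exp t) :=
  contMDiff_iff_contDiff.1 (f.contMDiff.comp contMDiff_circleExp)

/-- High powers of functions of modulus less than one with disjoint supports
can be glued to a `C^k` function. -/
theorem exists_glue_pow {k : ℕ∞} (a : ℕ → CkCircle k) (W : ℕ → Set Circle)
    (hW : Pairwise (Disjoint on W)) (supp : ∀ n, ∀ x ∉ W n, a n x = 0)
    (hlt : ∀ n x, |a n x| < 1) (M : ℕ → ℕ) :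
    ∃ (m : ℕ → ℕ) (h : CkCircle k), (∀ n, M n ≤ m n) ∧ ∀ n, ∀ x ∈ W n, h x = a n x ^ m n := by
  -- Bounding only orders `j ≤ n` still covers `k = ∞`: each fixed `j` is controlled for all but
  -- finitely many `n`. The condition `1 ≤ m` makes the power vanish off `W n`.
  have hex : ∀ n, ∃ m : ℕ, M n ≤ m ∧ 1 ≤ m ∧ ∀ j : ℕ, j ≤ n → (j : ℕ∞) ≤ k → ∀ x,
      |iteratedDeriv j (fun t : ℝ => a n (Circle.exp t) ^ m) x| ≤ (1 / 2) ^ n := by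
    intro n
    have h : ∀ j ∈ Finset.range (n + 1), ∀ᶠ m : ℕ in atTop, (j : ℕ∞) ≤ k → ∀ x,
        |iteratedDeriv j (fun t : ℝ => a n (Circle.exp t) ^ m) x| ≤ (1 / 2) ^ n := by
      intro j _
      by_cases hj : (j : ℕ∞) ≤ k
      · have := eventually_abs_iteratedDeriv_mul_pow_le Real.two_pi_pos j 0
          (a := fun t => a n (Circle.exp t)) (b := fun _ => 1)
          ((a n).contDiff_comp_exp.of_le (by exact_mod_cast hj)) contDiff_const
          (fun t => by simp only [Circle.exp_add_two_pi]) (fun _ => rfl)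
          (fun x => hlt n _) ((1 / 2) ^ n) (by positivity)
        filter_upwards [this] with m hm _ x
        simpa using hm x
      · exact Eventually.of_forall fun _ h => absurd h hj
    obtain ⟨m, h1, h2, h3⟩ := ((eventually_ge_atTop (M n)).and ((eventually_ge_atTop 1).and
      ((Finset.eventually_all _).2 h))).exists
    exact ⟨m, h1, h2, fun j hj => h3 j (Finset.mem_range.2 (Nat.lt_succ_of_le hj))⟩
  choose m hM hm1 hm using hex
  refine ⟨m, ⟨fun x => ∑' n, a n x ^ m n, Circle.contMDiff_of_comp_exp ?_⟩, hM, ?_⟩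
  · refine contDiff_tsum_of_eventually (v := fun _ n => (1 / 2 : ℝ) ^ n)
      (fun n => (a n).contDiff_comp_exp.pow _) (fun _ _ => summable_geometric_two) ?_
    intro j hj
    rw [Nat.cofinite_eq_atTop]
    filter_upwards [eventually_ge_atTop j] with n hn x
    rw [norm_iteratedFDeriv_eq_norm_iteratedDeriv]
    exact hm n j hn (by exact_mod_cast hj) x
  · intro n x hx
    refine tsum_eq_single n fun i hi => ?_
    have : x ∉ W i := fun h => (disjoint_left.1 (hW hi)) h hx
    rw [supp i x this, zero_pow (Nat.one_le_iff_ne_zero.1 (hm1 i))]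

end CkCircle

/-- An infinite subset of a metric space contains a sequence of points
with pairwise disjoint neighbourhoods. -/
theorem Set.Infinite.exists_seq_pairwise_disjoint_nhds {X : Type*} [MetricSpace X] {B : Set X}
    (hB : B.Infinite) : ∃ (x : ℕ → X) (W : ℕ → Set X), (∀ n, x n ∈ B) ∧ (∀ n, W n ∈ 𝓝 (x n)) ∧
      Pairwise (Disjoint on W) := by
  have : Infinite B := hB.to_subtype
  obtain ⟨U, hinf, ho, hd⟩ := exists_seq_infinite_isOpen_pairwise_disjoint B
  choose x hx using fun n => (hinf n).nonempty
  have hr : ∀ n, ∃ r > 0, Metric.ball (x n) r ⊆ U n := fun n =>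
    Metric.isOpen_iff.1 (ho n) _ (hx n)
  choose r r0 hr using hr
  -- The sets `U n` are open and disjoint only inside `B`; halving the radii gives balls disjoint in
  -- `X`.
  have hne : ∀ i j, i ≠ j → r i ≤ dist (x i : X) (x j) := by
    intro i j hij
    by_contra! h
    refine disjoint_left.1 (hd hij) (hr i ?_) (hx j)
    rw [Metric.mem_ball, dist_comm]
    exact h
  refine ⟨fun n => x n, fun n => Metric.ball (x n) (r n / 2), fun n => (x n).2,
    fun n => Metric.ball_mem_nhds _ (half_pos (r0 n)), fun i j hij => ?_⟩
  refine Metric.ball_disjoint_ball ?_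
  have h1 := hne i j hij
  have h2 := hne j i hij.symm
  rw [dist_comm] at h2
  linarith

/-! ### The logarithmic functional and the exponent. -/

namespace CkCircle

/-- `T (e^φ)` is the square of `T (e^(φ/2))`, and it has no zeros. -/
theorem map_exp_pos {k : ℕ∞} (T : CkCircle k ≃* CkCircle k) (φ : CkCircle k) (y : Circle) :
    0 < T (exp φ) y := by
  obtain ⟨x, rfl⟩ := (pointHomeo T).surjective y
  have e : exp φ = exp (const k (1 / 2) * φ) * exp (const k (1 / 2) * φ) := by
    rw [← exp_add]
    congr 1
    ext y
    simp only [add_apply, mul_apply, const_apply]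
    ring
  have h0 : T (exp φ) (pointMap T x) ≠ 0 := map_apply_ne_zero T (Real.exp_pos _).ne'
  refine lt_of_le_of_ne ?_ h0.symm
  rw [e, map_mul]
  exact mul_self_nonneg _

/-- The additive functional `φ ↦ log (T (e^φ) (y))`. -/
noncomputable def logMap {k : ℕ∞} (T : CkCircle k ≃* CkCircle k) (y : Circle) :
    CkCircle k →+ ℝ where
  toFun φ := Real.log (T (exp φ) y)
  map_zero' := by simp [exp_zero]
  map_add' φ ψ := by
    rw [exp_add, map_mul, mul_apply,
      Real.log_mul (map_exp_pos T φ y).ne' (map_exp_pos T ψ y).ne']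

theorem exp_logMap {k : ℕ∞} (T : CkCircle k ≃* CkCircle k) (y : Circle) (φ : CkCircle k) :
    Real.exp (logMap T y φ) = T (exp φ) y :=
  Real.exp_log (map_exp_pos T φ y)

theorem continuous_logMap {k : ℕ∞} (T : CkCircle k ≃* CkCircle k) (φ : CkCircle k) :
    Continuous fun y => logMap T y φ :=
  (T (exp φ)).continuous_coe.log fun y => (map_exp_pos T φ y).ne'

/-- A monotone additive functional at a point is a multiple of the evaluation. -/
theorem addMonoidHom_eq_mul_of_nonpos {k : ℕ∞} (L : CkCircle k →+ ℝ) (x : Circle)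
    (h : ∀ φ : CkCircle k, φ x < 0 → L φ ≤ 0) (φ : CkCircle k) : L φ = L 1 * φ x := by
  have h1 : 0 ≤ L 1 := by
    have := h (-1) (by simp)
    rw [map_neg] at this
    linarith
  have key : ∀ ψ : CkCircle k, L ψ ≤ L 1 * ψ x := by
    intro ψ
    by_contra! hlt
    -- Integer multiples suffice: comparing `n • ψ` with the integer constant just above `n * ψ x`
    -- loses at most `L 1`, negligible for large `n`.
    obtain ⟨n, hn⟩ := exists_nat_gt (L 1 / (L ψ - L 1 * ψ x))
    rw [div_lt_iff₀ (by linarith)] at hn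
    have hN := h (n • ψ - ((⌊(n : ℝ) * ψ x⌋ + 1 : ℤ) • (1 : CkCircle k))) (by
      have e : ((⌊(n : ℝ) * ψ x⌋ + 1 : ℤ) • (1 : CkCircle k)) x = (⌊(n : ℝ) * ψ x⌋ + 1 : ℤ) := by
        generalize ⌊(n : ℝ) * ψ x⌋ + 1 = N
        obtain ⟨N, rfl | rfl⟩ := N.eq_nat_or_neg <;> simp
      rw [sub_apply, nsmul_apply, e]
      push_cast
      linarith [Int.lt_floor_add_one ((n : ℝ) * ψ x)])
    rw [map_sub, map_nsmul, map_zsmul, nsmul_eq_mul, zsmul_eq_mul] at hN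
    push_cast at hN
    have := mul_le_mul_of_nonneg_right (Int.floor_le ((n : ℝ) * ψ x)) h1
    linarith
  have h2 := key (-φ)
  rw [map_neg, neg_apply] at h2
  exact le_antisymm (key φ) (by linarith)

/-- At all but finitely many points the functional `φ ↦ log (T (e^φ))` is monotone. -/
theorem finite_setOf_logMap_pos {k : ℕ∞} (T : CkCircle k ≃* CkCircle k) :
    {x : Circle | ∃ φ : CkCircle k, φ x < 0 ∧ 0 < logMap T (pointMap T x) φ}.Finite := by
  by_contra hinf
  obtain ⟨x, W, hx, hW, hd⟩ := Set.Infinite.exists_seq_pairwise_disjoint_nhds hinf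
  choose φ hneg hpos using hx
  have hb : ∀ n, ∃ b : CkCircle k, b =ᶠ[𝓝 (x n)] 1 ∧ tsupport b ⊆ W n ∩ {y | φ n y < 0} ∧
      ∀ y, b y ∈ Icc (0 : ℝ) 1 := fun n =>
    exists_bump (x n) (inter_mem (hW n)
      ((φ n).continuous_coe.continuousAt.eventually (gt_mem_nhds (hneg n))))
  choose b b1 bs bI using hb
  obtain ⟨m, h, hm, hh⟩ := exists_glue_pow (fun n => b n * exp (φ n)) W hd
    (fun n y hy => by
      have : b n y = 0 := by
        by_contra h0
        exact hy (bs n (subset_tsupport _ h0)).1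
      simp [this])
    (fun n y => by
      by_cases h0 : b n y = 0
      · simp [h0]
      · have h1 : φ n y < 0 := (bs n (subset_tsupport _ h0)).2
        rw [mul_apply, exp_apply, abs_mul, abs_of_nonneg (bI n y).1, abs_of_pos (Real.exp_pos _)]
        exact (mul_le_of_le_one_left (Real.exp_pos _).le (bI n y).2).trans_lt
          (by rwa [← Real.exp_zero, Real.exp_lt_exp]))
    -- This bound on the powers makes `log (T h)` at least `n` at the image of `x n`.
    (fun n => ⌈n / logMap T (pointMap T (x n)) (φ n)⌉₊)
  obtain ⟨C, hC⟩ := isCompact_univ.exists_bound_of_continuousOn (T h).continuous_coe.continuousOn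
  obtain ⟨n, hn⟩ := exists_nat_gt C
  have e : h =ᶠ[𝓝 (x n)] exp (m n • φ n) := by
    filter_upwards [b1 n, hW n] with y h1 h2
    rw [hh n y h2, mul_apply, h1, exp_apply, exp_apply, Pi.one_apply, one_mul, nsmul_apply,
      Real.exp_nat_mul]
  have h1 := map_apply_congr T e
  rw [← exp_logMap, map_nsmul, nsmul_eq_mul] at h1
  have h2 := (Nat.ceil_le.1 (hm n))
  rw [div_le_iff₀ (hpos n)] at h2
  have h3 := hC (pointMap T (x n)) (mem_univ _)
  rw [h1, Real.norm_eq_abs, abs_of_pos (Real.exp_pos _)] at h3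
  have h4 := Real.add_one_le_exp ((m n : ℝ) * logMap T (pointMap T (x n)) (φ n))
  linarith

theorem dense_setOf_logMap_nonpos {k : ℕ∞} (T : CkCircle k ≃* CkCircle k) :
    Dense {x : Circle | ∀ φ : CkCircle k, φ x < 0 → logMap T (pointMap T x) φ ≤ 0} := by
  have : Nontrivial Circle := ⟨1, Circle.exp Real.pi, fun h => by
    have := congrArg (fun z : Circle => (z : ℂ)) h
    norm_num at this⟩
  refine (dense_univ.sdiff_finite (finite_setOf_logMap_pos T)).mono fun x hx φ hφ => ?_
  by_contra! hlt
  exact hx.2 ⟨φ, hφ, hlt⟩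

/-- Both sides are continuous in `x` and agree on the dense set where the functional is monotone. -/
theorem logMap_eq {k : ℕ∞} (T : CkCircle k ≃* CkCircle k) (x : Circle) (φ : CkCircle k) :
    logMap T (pointMap T x) φ = logMap T (pointMap T x) 1 * φ x := by
  have hc : ∀ ψ : CkCircle k, Continuous fun x => logMap T (pointMap T x) ψ :=
    fun ψ => (continuous_logMap T ψ).comp (continuous_pointMap T)
  exact congrFun (Continuous.ext_on (dense_setOf_logMap_nonpos T)
    (hc φ) ((hc 1).mul φ.continuous_coe) fun y hy => addMonoidHom_eq_mul_of_nonpos _ y hy φ) x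

/-- The exponent of a multiplicative bijection. -/
noncomputable def exponent {k : ℕ∞} (T : CkCircle k ≃* CkCircle k) (y : Circle) : ℝ :=
  logMap T y 1

theorem continuous_exponent {k : ℕ∞} (T : CkCircle k ≃* CkCircle k) : Continuous (exponent T) :=
  continuous_logMap T 1

theorem map_exp_apply {k : ℕ∞} (T : CkCircle k ≃* CkCircle k) (φ : CkCircle k) (x : Circle) :
    T (exp φ) (pointMap T x) = Real.exp (exponent T (pointMap T x) * φ x) := by
  rw [← exp_logMap, logMap_eq, exponent]

theorem exponent_pos {k : ℕ∞} (T : CkCircle k ≃* CkCircle k) (y : Circle) :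
    0 < exponent T y := by
  obtain ⟨x, rfl⟩ := (pointHomeo T).surjective y
  change 0 < exponent T (pointMap T x)
  -- A zero exponent would send every local exponential to `1`, so every nonzero value of an image
  -- would have square `1`; but the constant `e` is an image.
  have hne : exponent T (pointMap T x) ≠ 0 := by
    intro h0
    obtain ⟨f, hf⟩ := T.surjective (exp 1)
    have hfx : f x ≠ 0 := by
      rw [Ne, ← map_apply_eq_zero_iff T, hf]
      exact (Real.exp_pos _).ne'
    obtain ⟨φ, hφ⟩ := exists_eventuallyEq_exp (f * f) (x := x) (mul_self_pos.2 hfx)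
    have := map_apply_congr T hφ
    rw [map_exp_apply, h0, zero_mul, map_mul, hf, ← exp_add, exp_apply, Real.exp_eq_exp] at this
    simp only [add_apply, one_apply] at this
    norm_num at this
  have hcl : IsClosed {x | 0 ≤ exponent T (pointMap T x)} :=
    isClosed_le continuous_const ((continuous_exponent T).comp (continuous_pointMap T))
  have hnn : x ∈ {x | 0 ≤ exponent T (pointMap T x)} := by
    refine hcl.closure_subset_iff.2 (fun z hz => ?_) (dense_setOf_logMap_nonpos T x)
    have := hz (-1) (by simp)
    rw [map_neg] at this
    exact neg_nonpos.1 this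
  exact lt_of_le_of_ne hnn hne.symm

/-- `T (-1)` is a square root of `1` other than `1`; by connectedness of the circle it has constant
sign. -/
theorem map_neg_one {k : ℕ∞} (T : CkCircle k ≃* CkCircle k) : T (-1) = -1 := by
  have hsq : T (-1) * T (-1) = 1 := by rw [← map_mul]; simp
  have hpt : ∀ y, T (-1) y = 1 ∨ T (-1) y = -1 := fun y =>
    mul_self_eq_one_iff.1 (DFunLike.congr_fun hsq y)
  have hne : T (-1) ≠ 1 := by
    rw [Ne, map_eq_one_iff T T.injective]
    intro h
    have := DFunLike.congr_fun h (1 : Circle)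
    norm_num at this
  have hex : ∃ y, T (-1) y ≠ 1 := by
    by_contra! h
    exact hne (DFunLike.ext _ _ h)
  obtain ⟨y, hy⟩ := hex
  ext z
  refine (hpt z).resolve_left fun hz => ?_
  obtain ⟨w, hw⟩ : (0 : ℝ) ∈ range (T (-1)) :=
    mem_range_of_exists_le_of_exists_ge (T (-1)).continuous_coe
      ⟨y, by rw [(hpt y).resolve_left hy]; norm_num⟩ ⟨z, by rw [hz]; norm_num⟩
  rcases hpt w with h | h <;> rw [hw] at h <;> norm_num at h

theorem map_apply_of_pos {k : ℕ∞} (T : CkCircle k ≃* CkCircle k) {f : CkCircle k} {x : Circle}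
    (hf : 0 < f x) : T f (pointMap T x) = f x ^ exponent T (pointMap T x) := by
  obtain ⟨φ, hφ⟩ := exists_eventuallyEq_exp f hf
  rw [map_apply_congr T hφ, map_exp_apply, hφ.self_of_nhds, exp_apply, mul_comm, Real.exp_mul]

/-- Multiplicative bijections of `C^k` are given by a change of variables and a power. -/
theorem map_apply {k : ℕ∞} (T : CkCircle k ≃* CkCircle k) (f : CkCircle k) (y : Circle) :
    T f y = |f (pointMap T.symm y)| ^ exponent T y * Real.sign (f (pointMap T.symm y)) := by
  have hy : pointMap T (pointMap T.symm y) = y := pointMap_symm_pointMap T.symm y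
  set x := pointMap T.symm y
  rw [← hy]
  rcases lt_trichotomy (f x) 0 with h | h | h
  · have e : f = -1 * -f := by simp
    have h' : 0 < (-f) x := by simpa using h
    rw [Real.sign_of_neg h, abs_of_neg h]
    conv_lhs => rw [e, map_mul, map_neg_one, mul_apply, map_apply_of_pos T h']
    simp
  · rw [(map_apply_eq_zero_iff T).2 h, h, Real.sign_zero, mul_zero]
  · rw [Real.sign_of_pos h, abs_of_pos h, map_apply_of_pos T h, mul_one]

end CkCircle

/-! ### Smoothness of the change of variables; exponent one for `k ≥ 1`. -/

theorem Circle.contMDiff_coe {n : WithTop ℕ∞} :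
    ContMDiff (𝓡 1) 𝓘(ℝ, ℂ) n (fun z : Circle => (z : ℂ)) :=
  have : Fact (Module.finrank ℝ ℂ = 1 + 1) := finrank_real_complex_fact'
  contMDiff_coe_sphere

namespace CkCircle

/-- `log (T (e^φ))` as a `C^k` function. -/
noncomputable def logFun {k : ℕ∞} (T : CkCircle k ≃* CkCircle k) (φ : CkCircle k) : CkCircle k :=
  ⟨fun y => logMap T y φ, fun y =>
    (Real.contDiffAt_log.2 (map_exp_pos T φ y).ne').contMDiffAt.comp y ((T (exp φ)).contMDiff y)⟩

theorem logFun_apply {k : ℕ∞} (T : CkCircle k ≃* CkCircle k) (φ : CkCircle k) (y : Circle) :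
    logFun T φ y = logMap T y φ := rfl

theorem exp_logFun {k : ℕ∞} (T : CkCircle k ≃* CkCircle k) (φ : CkCircle k) :
    exp (logFun T φ) = T (exp φ) := by
  ext y
  exact exp_logMap T y φ

/-- Both numerator and denominator are `C^k` in `y`, the denominator being `logFun T 1`; this is the
source of smoothness of the point map, applied to the coordinates `re` and `im`. -/
theorem apply_pointMap_symm {k : ℕ∞} (T : CkCircle k ≃* CkCircle k) (φ : CkCircle k)
    (y : Circle) : φ (pointMap T.symm y) = logFun T φ y / exponent T y := by
  have hy : pointMap T (pointMap T.symm y) = y := pointMap_symm_pointMap T.symm y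
  have h := logMap_eq T (pointMap T.symm y) φ
  rw [hy] at h
  rw [eq_div_iff (exponent_pos T y).ne', logFun_apply, h, exponent, mul_comm]

theorem contMDiff_comp_pointMap_symm {k : ℕ∞} (T : CkCircle k ≃* CkCircle k) (φ : CkCircle k) :
    ContMDiff (𝓡 1) 𝓘(ℝ, ℝ) k fun y => φ (pointMap T.symm y) := by
  simp_rw [apply_pointMap_symm T φ]
  exact (logFun T φ).contMDiff.div₀ (logFun T 1).contMDiff fun y => (exponent_pos T y).ne'

theorem contMDiff_pointMap_symm {k : ℕ∞} (T : CkCircle k ≃* CkCircle k) :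
    ContMDiff (𝓡 1) (𝓡 1) k (pointMap T.symm) := by
  have hre := contMDiff_comp_pointMap_symm T
    ⟨fun z => (z : ℂ).re, Complex.reCLM.contDiff.contMDiff.comp Circle.contMDiff_coe⟩
  have him := contMDiff_comp_pointMap_symm T
    ⟨fun z => (z : ℂ).im, Complex.imCLM.contDiff.contMDiff.comp Circle.contMDiff_coe⟩
  have h : ContMDiff (𝓡 1) 𝓘(ℝ, ℂ) k fun y => (pointMap T.symm y : ℂ) :=
    Complex.equivRealProdCLM.symm.contDiff.contMDiff.comp (hre.prodMk_space him)
  have : Fact (Module.finrank ℝ ℂ = 1 + 1) := finrank_real_complex_fact'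
  exact h.codRestrict_sphere _

/-- The point map of a multiplicative bijection, as a diffeomorphism. -/
noncomputable def pointDiffeo {k : ℕ∞} (T : CkCircle k ≃* CkCircle k) :
    Circle ≃ₘ^(k : WithTop ℕ∞)⟮𝓡 1, 𝓡 1⟯ Circle where
  toEquiv := (pointHomeo T).toEquiv
  contMDiff_toFun := contMDiff_pointMap_symm T.symm
  contMDiff_invFun := contMDiff_pointMap_symm T

/-- Sending the constant `e` through `T` and back multiplies its logarithm by both exponents. -/
theorem exponent_symm_mul_exponent {k : ℕ∞} (T : CkCircle k ≃* CkCircle k) (x : Circle) :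
    exponent T.symm x * exponent T (pointMap T x) = 1 := by
  have h := map_exp_apply T.symm (logFun T 1) (pointMap T x)
  rw [exp_logFun, T.symm_apply_apply, pointMap_symm_pointMap, exp_apply, Real.exp_eq_exp] at h
  exact h.symm

/-- A signed power of the sine which is differentiable at `0` has exponent at least `1` there. -/
theorem _root_.Real.one_le_of_differentiableAt_abs_sin_rpow {p : ℝ → ℝ} (hp : ContinuousAt p 0)
    (hd : DifferentiableAt ℝ (fun t => |Real.sin t| ^ p t * Real.sign (Real.sin t)) 0) :
    1 ≤ p 0 := by
  by_contra! hlt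
  obtain ⟨q, hq, hq1⟩ := exists_between hlt
  obtain ⟨C, hC⟩ := (hd.isBigO_sub).bound
  -- With `p 0 < q < 1`, `sin t ^ q ≤ sin t ^ p t ≤ C * t ≤ C * (π / 2) * sin t`; dividing by `sin t
  -- ^ q` leaves a right side tending to `0`.
  have hS : ∀ᶠ t in 𝓝[>] (0 : ℝ), 1 ≤ C * (Real.pi / 2) * Real.sin t ^ (1 - q) := by
    filter_upwards [nhdsWithin_le_nhds hC, nhdsWithin_le_nhds (hp.eventually (gt_mem_nhds hq)),
      self_mem_nhdsWithin, nhdsWithin_le_nhds (gt_mem_nhds (half_pos Real.pi_pos))]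
      with t h1 h2 h3 h4
    have h3' : (0 : ℝ) < t := h3
    have hs : 0 < Real.sin t := Real.sin_pos_of_pos_of_lt_pi h3' (by linarith)
    rw [Real.sin_zero, Real.sign_zero, mul_zero, sub_zero, sub_zero, Real.sign_of_pos hs, mul_one,
      abs_of_pos hs, Real.norm_eq_abs, Real.norm_eq_abs, abs_of_pos h3',
      abs_of_pos (Real.rpow_pos_of_pos hs _)] at h1
    have h5 : Real.sin t ^ q ≤ Real.sin t ^ p t :=
      Real.rpow_le_rpow_of_exponent_ge hs (Real.sin_le_one t) h2.le
    have h6 := Real.mul_le_sin h3'.le h4.le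
    have h7 : t ≤ Real.pi / 2 * Real.sin t := by
      have := mul_le_mul_of_nonneg_left h6 (half_pos Real.pi_pos).le
      have e : Real.pi / 2 * (2 / Real.pi * t) = t := by
        field_simp
      rwa [e] at this
    have hq0 : 0 < Real.sin t ^ q := Real.rpow_pos_of_pos hs _
    have hC0 : 0 < C := by
      by_contra! h
      exact absurd (hq0.trans_le (h5.trans h1)) (mul_nonpos_of_nonpos_of_nonneg h h3'.le).not_gt
    rw [Real.rpow_sub hs, Real.rpow_one, ← mul_div_assoc, le_div_iff₀ hq0, one_mul, mul_assoc]
    exact (h5.trans h1).trans (mul_le_mul_of_nonneg_left h7 hC0.le)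
  have ht : Tendsto (fun t => C * (Real.pi / 2) * Real.sin t ^ (1 - q)) (𝓝[>] 0) (𝓝 0) := by
    have hc : ContinuousAt (fun t => C * (Real.pi / 2) * Real.sin t ^ (1 - q)) 0 :=
      (Real.continuous_sin.continuousAt.rpow_const (Or.inr (by linarith))).const_mul _
    have := hc.tendsto
    rw [Real.sin_zero, Real.zero_rpow (by linarith), mul_zero] at this
    exact this.mono_left nhdsWithin_le_nhds
  have := ge_of_tendsto ht hS
  norm_num at this

theorem one_le_exponent {k : ℕ∞} (hk : 1 ≤ k) (T : CkCircle k ≃* CkCircle k) (y : Circle) :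
    1 ≤ exponent T y := by
  obtain ⟨t₀, rfl⟩ := Circle.exp_surjective y
  have hg : ContMDiff (𝓡 1) 𝓘(ℝ, ℝ) k
      (fun z : Circle => ((z * (Circle.exp t₀)⁻¹ : Circle) : ℂ).im) :=
    Complex.imCLM.contDiff.contMDiff.comp
      (Circle.contMDiff_coe.comp (ContMDiff.mul contMDiff_id contMDiff_const))
  -- A sine centred at `y`, composed with the point map, so that the formula for `T f` reads as a
  -- signed power of `sin t`.
  let f : CkCircle k := ⟨_, hg.comp (contMDiff_pointMap_symm T.symm)⟩
  have hf : ∀ t : ℝ, f (pointMap T.symm (Circle.exp (t + t₀))) = Real.sin t := by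
    intro t
    change ((pointMap T (pointMap T.symm (Circle.exp (t + t₀))) *
      (Circle.exp t₀)⁻¹ : Circle) : ℂ).im = _
    have : pointMap T (pointMap T.symm (Circle.exp (t + t₀))) = Circle.exp (t + t₀) :=
      pointMap_symm_pointMap T.symm _
    rw [this, Circle.exp_add, mul_inv_cancel_right, Circle.coe_exp, Complex.exp_ofReal_mul_I_im]
  have hd : DifferentiableAt ℝ (fun t : ℝ => T f (Circle.exp (t + t₀))) 0 := by
    have h1 : ContDiff ℝ k fun t : ℝ => T f (Circle.exp (t + t₀)) :=
      (T f).contDiff_comp_exp.comp (contDiff_id.add contDiff_const)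
    refine (h1.differentiable ?_) 0
    rintro h0
    have : k = 0 := by exact_mod_cast h0
    rw [this] at hk
    exact absurd hk (by decide)
  simp_rw [map_apply T f, hf] at hd
  have hp : Continuous fun t : ℝ => exponent T (Circle.exp (t + t₀)) :=
    (continuous_exponent T).comp (Circle.exp.continuous.comp (continuous_id.add continuous_const))
  have := Real.one_le_of_differentiableAt_abs_sin_rpow hp.continuousAt hd
  rwa [zero_add] at this

theorem exponent_eq_one {k : ℕ∞} (hk : 1 ≤ k) (T : CkCircle k ≃* CkCircle k) (y : Circle) :
    exponent T y = 1 := by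
  have h := exponent_symm_mul_exponent T (pointMap T.symm y)
  have hy : pointMap T (pointMap T.symm y) = y := pointMap_symm_pointMap T.symm y
  rw [hy] at h
  have h1 := one_le_exponent hk T y
  have h2 := one_le_exponent hk T.symm (pointMap T.symm y)
  nlinarith

theorem map_apply_of_one_le {k : ℕ∞} (hk : 1 ≤ k) (T : CkCircle k ≃* CkCircle k)
    (f : CkCircle k) (y : Circle) : T f y = f (pointMap T.symm y) := by
  rw [map_apply, exponent_eq_one hk, Real.rpow_one]
  rcases lt_trichotomy (f (pointMap T.symm y)) 0 with h | h | h
  · rw [Real.sign_of_neg h, abs_of_neg h, mul_neg_one, neg_neg]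
  · rw [h, Real.sign_zero, mul_zero]
  · rw [Real.sign_of_pos h, abs_of_pos h, mul_one]

end CkCircle

/-! ### Fourier coefficients and convolution. -/

namespace CkCircle

local instance fact_two_pi_pos : Fact (0 < 2 * Real.pi) := ⟨Real.two_pi_pos⟩

/-- The complex-valued function on `ℝ / 2πℤ` given by a function on the circle. -/
noncomputable def toAddCircle {k : ℕ∞} (f : CkCircle k) : C(AddCircle (2 * Real.pi), ℂ) :=
  ⟨fun x => (f (AddCircle.toCircle x) : ℂ),
    Complex.continuous_ofReal.comp (f.continuous_coe.comp AddCircle.continuous_toCircle)⟩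

theorem toAddCircle_coe {k : ℕ∞} (f : CkCircle k) (x : ℝ) :
    f.toAddCircle (x : AddCircle (2 * Real.pi)) = (f (Circle.exp x) : ℂ) := by
  change ((f (AddCircle.toCircle (x : AddCircle (2 * Real.pi))) : ℝ) : ℂ) = _
  rw [AddCircle.toCircle_apply_mk, div_self Real.two_pi_pos.ne', one_mul]

theorem toAddCircle_mul {k : ℕ∞} (f g : CkCircle k) :
    (f * g).toAddCircle = f.toAddCircle * g.toAddCircle := by
  ext x
  exact Complex.ofReal_mul _ _

theorem conj_toAddCircle {k : ℕ∞} (f : CkCircle k) (x : AddCircle (2 * Real.pi)) :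
    conj (f.toAddCircle x) = f.toAddCircle x :=
  Complex.conj_ofReal _

theorem toAddCircle_injective {k : ℕ∞} : Injective (toAddCircle (k := k)) := by
  intro f g h
  ext z
  obtain ⟨t, rfl⟩ := Circle.exp_surjective z
  have := DFunLike.congr_fun h (t : AddCircle (2 * Real.pi))
  rw [toAddCircle_coe, toAddCircle_coe] at this
  exact_mod_cast this

/-- The `L²` class of a function on the circle. -/
noncomputable def toL2 (f : C(AddCircle (2 * Real.pi), ℂ)) :
    MeasureTheory.Lp ℂ 2 (AddCircle.haarAddCircle (T := 2 * Real.pi)) :=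
  ContinuousMap.toLp (E := ℂ) 2 AddCircle.haarAddCircle ℂ f

theorem fourierSeq_eq_fourierCoeff {k : ℕ∞} (f : CkCircle k) (n : ℤ) :
    fourierSeq f n = fourierCoeff f.toAddCircle n := by
  rw [fourierSeq, fourierCoeffOn_eq_integral, fourierCoeff_eq_intervalIntegral _ n 0]
  simp only [fourier_coe_apply, sub_zero, zero_add, toAddCircle_coe]

theorem fourierCoeff_toL2 (f : C(AddCircle (2 * Real.pi), ℂ)) (n : ℤ) :
    fourierBasis.repr (toL2 f) n = fourierCoeff f n := by
  rw [fourierBasis_repr]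
  exact congrFun (fourierCoeff_congr_ae (ContinuousMap.coeFn_toLp (p := 2) (𝕜 := ℂ) _ f)) n

/-- The square-summability condition in `fourierClass` is thus automatic. -/
theorem memℓp_fourierSeq {k : ℕ∞} (f : CkCircle k) : Memℓp (fourierSeq f) 2 := by
  have : fourierSeq f = fourierBasis.repr (toL2 f.toAddCircle) := by
    ext n
    rw [fourierCoeff_toL2, fourierSeq_eq_fourierCoeff]
  rw [this]
  exact lp.memℓp _

theorem fourierSeq_injective {k : ℕ∞} : Injective (fourierSeq (k := k)) := by
  intro f g h
  refine toAddCircle_injective (ContinuousMap.toLp_injective (p := 2) (𝕜 := ℂ)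
    AddCircle.haarAddCircle (fourierBasis.repr.injective ?_))
  ext n
  change fourierBasis.repr (toL2 f.toAddCircle) n = fourierBasis.repr (toL2 g.toAddCircle) n
  rw [fourierCoeff_toL2, fourierCoeff_toL2, ← fourierSeq_eq_fourierCoeff,
    ← fourierSeq_eq_fourierCoeff, h]

theorem inner_toL2 (f g : C(AddCircle (2 * Real.pi), ℂ)) :
    inner ℂ (toL2 f) (toL2 g) = ∫ x, g x * conj (f x) ∂AddCircle.haarAddCircle :=
  MeasureTheory.ContinuousMap.inner_toLp _ _ _

/-- Parseval for the pair `e_n * g`, `f`: since `g` is real, `⟪e_n * g, e_j⟫` is the coefficient of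
`g` at `n - j`. -/
theorem fourierSeq_mul {k : ℕ∞} (f g : CkCircle k) :
    fourierSeq (f * g) = seqConv (fourierSeq f) (fourierSeq g) := by
  ext n
  have h := fourierBasis.tsum_inner_mul_inner (toL2 (fourier n * g.toAddCircle))
    (toL2 f.toAddCircle)
  have hb : ∀ j : ℤ, (fourierBasis (T := 2 * Real.pi)) j = toL2 (fourier j) := fun j => by
    rw [coe_fourierBasis]
    rfl
  rw [seqConv, fourierSeq_eq_fourierCoeff, toAddCircle_mul]
  refine Eq.trans ?_ (h.symm.trans (tsum_congr fun j => ?_))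
  · rw [inner_toL2, fourierCoeff]
    refine MeasureTheory.integral_congr_ae (Eventually.of_forall fun x => ?_)
    simp only [ContinuousMap.mul_apply, map_mul, conj_toAddCircle, fourier_neg, smul_eq_mul]
    ring
  · rw [hb, inner_toL2, inner_toL2, mul_comm, fourierSeq_eq_fourierCoeff,
      fourierSeq_eq_fourierCoeff, fourierCoeff, fourierCoeff]
    congr 1
    · refine MeasureTheory.integral_congr_ae (Eventually.of_forall fun x => ?_)
      simp only [fourier_neg, smul_eq_mul]
      ring
    · refine MeasureTheory.integral_congr_ae (Eventually.of_forall fun x => ?_)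
      simp only [ContinuousMap.mul_apply, map_mul, conj_toAddCircle, smul_eq_mul]
      rw [neg_sub, sub_eq_add_neg, fourier_add, fourier_neg]
      ring

/-- A bijection onto the Fourier coefficients turning products into convolutions is the Fourier
transform of a multiplicative bijection. -/
theorem exists_mulEquiv_fourierSeq {k : ℕ∞} (F : CkCircle k → fourierClass k)
    (hF : Bijective F)
    (hmul : ∀ f g : CkCircle k, (F (f * g) : ℤ → ℂ) = seqConv (F f) (F g)) :
    ∃ T : CkCircle k ≃* CkCircle k, ∀ f, (F f : ℤ → ℂ) = fourierSeq (T f) := by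
  choose T hT using fun f => (F f).2.2
  have hinj : Injective T := fun f g h => hF.1 (Subtype.ext (by rw [← hT f, ← hT g, h]))
  have hsurj : Surjective T := fun g => by
    obtain ⟨f, hf⟩ := hF.2 ⟨fourierSeq g, memℓp_fourierSeq g, g, rfl⟩
    exact ⟨f, fourierSeq_injective (by rw [hT, hf])⟩
  refine ⟨MulEquiv.mk (Equiv.ofBijective T ⟨hinj, hsurj⟩) fun f g => ?_, fun f => (hT f).symm⟩
  refine fourierSeq_injective ?_
  change fourierSeq (T (f * g)) = fourierSeq (T f * T g)
  rw [fourierSeq_mul, hT, hT, hT, hmul]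

end CkCircle

theorem mainTheorem8 (k : ℕ∞) (F : CkCircle k → fourierClass k)
    (hF : Function.Bijective F)
    (hmul : ∀ f g : CkCircle k, (F (f * g) : ℤ → ℂ) = seqConv (F f) (F g)) :
    ∃ (p : Circle → ℝ) (u : Circle ≃ₘ^(k : WithTop ℕ∞)⟮𝓡 1, 𝓡 1⟯ Circle),
      Continuous p ∧ (∀ x, 0 < p x) ∧
      (∀ f : CkCircle k, ∃ g : CkCircle k,
        (∀ x, g x = |f (u x)| ^ (p x) * Real.sign (f (u x))) ∧
        (F f : ℤ → ℂ) = fourierSeq g) ∧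
      (1 ≤ k → (∀ x, p x = 1) ∧
        ∀ f : CkCircle k, (F f : ℤ → ℂ) = fourierSeq (f.comp ⟨u, u.contMDiff⟩)) := by
  obtain ⟨T, hT⟩ := CkCircle.exists_mulEquiv_fourierSeq F hF hmul
  refine ⟨CkCircle.exponent T, CkCircle.pointDiffeo T.symm, CkCircle.continuous_exponent T,
    CkCircle.exponent_pos T, fun f => ⟨T f, CkCircle.map_apply T f, hT f⟩,
    fun hk => ⟨CkCircle.exponent_eq_one hk T, fun f => ?_⟩⟩
  rw [hT]
  congr 1
  ext y
  exact CkCircle.map_apply_of_one_le hk T f y
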